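/- Consider four point bodies with nonzero real masses $m_1,\dots,m_4$ at pairwise distinct positions $r_1,\dots,r_4$ in the Euclidean plane, and put $\gamma_i=\sum_{j\neq i} m_j\,\frac{r_j-r_i}{\|r_j-r_i\|^3}$. The configuration is called central with multiplier $\xi\in\mathbb{R}$ if $\gamma_j-\gamma_i=\xi\,(r_j-r_i)$ for all $i,j$; it is called non-collinear if the four positions do not lie on a common line. (i) Let $x$ be a nonzero real number. There is no planar non-collinear central configuration with multiplier $0$ for the masses $x,-x,x,-x$. (ii) Let $x,y$ be nonzero real numbers with $x\neq y$ and $x\neq -y$. For the masses $(m_1,m_2,m_3,m_4)=(x,-x,y,-y)$ there exists a planar non-collinear central configuration with multiplier $0$, and it is unique up to similarities of the plane (reflections included) respecting the labels of the bodies. It is a parallelogram with diagonals $[r_1,r_2]$ and $[r_3,r_4]$: the bodies with masses $x$ and $-x$ are the endpoints of one diagonal, and the bodies with masses $y$ and $-y$ are the endpoints of the other. The two bodies whose masses have the smaller absolute value are the endpoints of the strictly longer diagonal. The two parallel sides whose endpoints have masses of the same sign are strictly longer than the other two sides. -/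

import Mathlib

/-- The Newtonian acceleration `γ i = ∑_{j ≠ i} m j (r j - r i) / ‖r j - r i‖ ^ 3` of body `i`. -/
noncomputable def acceleration {N : ℕ} {V : Type*} [NormedAddCommGroup V] [InnerProductSpace ℝ V]
    (m : Fin N → ℝ) (r : Fin N → V) (i : Fin N) : V :=
  ∑ j ∈ Finset.univ.erase i, (m j / ‖r j - r i‖ ^ 3) • (r j - r i)

/-- The configuration `r` of bodies with masses `m` is central with multiplier `ξ`. The bodies
occupy pairwise distinct positions, so that the accelerations are defined. -/
def IsCentralConfiguration {N : ℕ} {V : Type*} [NormedAddCommGroup V] [InnerProductSpace ℝ V]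
    (m : Fin N → ℝ) (r : Fin N → V) (ξ : ℝ) : Prop :=
  Function.Injective r ∧
    ∀ i j, acceleration m r j - acceleration m r i = ξ • (r j - r i)

/-- A planar non-collinear central configuration with multiplier `ξ`. -/
def IsPlanarNoncollinearCC {N : ℕ} (m : Fin N → ℝ) (r : Fin N → EuclideanSpace ℝ (Fin 2))
    (ξ : ℝ) : Prop :=
  IsCentralConfiguration m r ξ ∧ ¬ Collinear ℝ (Set.range r)

/-- `a b c d` (in this cyclic order) is a nondegenerate parallelogram. Its diagonals are
`[a, c]` and `[b, d]`. -/
def IsParallelogram {V : Type*} [NormedAddCommGroup V] [InnerProductSpace ℝ V]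
    (a b c d : V) : Prop :=
  b - a = c - d ∧ ¬ Collinear ℝ ({a, b, c} : Set V)

/-- The masses `x, -x, y, -y` of the four bodies. -/
def pairMasses (x y : ℝ) : Fin 4 → ℝ := ![x, -x, y, -y]

/-! Multiplier `0` means that all four accelerations coincide. The bodies of masses `x, -x`
accelerate each other equally, so the field of the pair `y, -y` must take the same value at `r 0`
and `r 1`. The planar field of two opposite charges is injective up to the point reflection in their
midpoint, except for pairs of points on their line (`two_centre_field_injective`). Non-collinearity
excludes that line, so both pairs have the same midpoint and the configuration is a parallelogram.

The heart of the injectivity is the open quadrant (`dipoleField_injOn_quadrant`). There a point is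
encoded by the mean `c` and half-difference `h` of the directions in which it is seen from the
charges. Direction and strength of the field give two relations between `c` and `h`, with opposite
monotonicities, so they have at most one solution. The symmetries of the field and a separate look
at the axes do the rest.

For a parallelogram, equality of accelerations splits along the diagonals into two scalar equations.
Together with the parallelogram law they form `ParallelogramBalance`. Up to scale this system has
exactly one realizable solution when `|x| ≠ |y|`: existence by the intermediate value theorem,
uniqueness by comparing the changes of `s⁻³` and `s²` on either side of `s = 1`. For `x = y` it has
none. -/

/-! ### Angular form of the dipole field and its monotonicity -/

/-- In the triangle with base `[-1, 1]` and apex `z`, the sides `α, β` have directions `σ, τ` and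
the apex angle is `2 * h`. Projecting the field on the direction `c` and on its normal isolates
`1/α² - 1/β²` and `1/α² + 1/β²`; the sine rule then eliminates `α` and `β`. -/
theorem dipole_angle_relations {σ τ θ α β ε : ℝ} (hτ : 0 < τ) (hσ : σ < Real.pi)
    (hθ0 : 0 < θ) (hθ1 : θ < Real.pi) (hτσ : τ < σ)
    (hα : 0 < α) (hαβ : α < β) (hε : 0 < ε)
    (hy : α * Real.sin σ = β * Real.sin τ)
    (hx : β * Real.cos τ - α * Real.cos σ = 2)
    (hc : ε * Real.cos θ = Real.cos σ / α ^ 2 - Real.cos τ / β ^ 2)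
    (hs : ε * Real.sin θ = Real.sin σ / α ^ 2 - Real.sin τ / β ^ 2) :
    ∃ c h : ℝ, σ = c + h ∧ τ = c - h ∧ 0 < h ∧ h < c ∧ c < Real.pi / 2 ∧
      0 < θ - c ∧ θ - c < c ∧
      Real.tan h ^ 2 = Real.tan c * (2 * Real.tan (θ - c) - Real.tan c) ∧
      ε * (Real.sin c * Real.sin (2 * c - θ) ^ 2) =
        Real.sin h ^ 3 * (Real.cos (θ - c) * Real.cos c) := by
  obtain ⟨c, hcdef⟩ : ∃ c, c = (σ + τ) / 2 := ⟨_, rfl⟩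
  obtain ⟨h, hhdef⟩ : ∃ h, h = (σ - τ) / 2 := ⟨_, rfl⟩
  obtain rfl : σ = c + h := by rw [hcdef, hhdef]; ring
  obtain rfl : τ = c - h := by linarith
  clear hcdef hhdef
  have hβ : 0 < β := hα.trans hαβ
  have hh0 : 0 < h := by linarith
  have hhc : h < c := by linarith
  have hcpi : c < Real.pi := by linarith
  have hhpi : h < Real.pi / 2 := by linarith
  have sh : 0 < Real.sin h := Real.sin_pos_of_pos_of_lt_pi hh0 (by linarith)
  have ch : 0 < Real.cos h := Real.cos_pos_of_mem_Ioo ⟨by linarith, hhpi⟩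
  have sc : 0 < Real.sin c := Real.sin_pos_of_pos_of_lt_pi (by linarith) hcpi
  have ssin : 0 < Real.sin (c + h) := Real.sin_pos_of_pos_of_lt_pi (by linarith) hσ
  have stau : 0 < Real.sin (c - h) := Real.sin_pos_of_pos_of_lt_pi hτ (by linarith)
  have hlt : Real.sin (c - h) < Real.sin (c + h) := by
    by_contra hle
    push Not at hle
    have := mul_le_mul_of_nonneg_left hle hα.le
    nlinarith
  have cc : 0 < Real.cos c := by
    rw [Real.sin_add, Real.sin_sub] at hlt
    by_contra hle
    push Not at hle
    nlinarith [mul_nonneg sh.le (neg_nonneg.2 hle)]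
  have hcpi2 : c < Real.pi / 2 := by
    by_contra hle
    push Not at hle
    exact absurd cc (not_lt.2 (Real.cos_nonpos_of_pi_div_two_le_of_le hle (by linarith)))
  have hinv : 1 / β ^ 2 < 1 / α ^ 2 := by gcongr
  -- components along the bisector direction
  have e1 : ε * Real.cos (θ - c) = Real.cos h * (1 / α ^ 2 - 1 / β ^ 2) := by
    have key : ε * Real.cos (θ - c) = (ε * Real.cos θ) * Real.cos c + (ε * Real.sin θ) * Real.sin c := by
      rw [Real.cos_sub]; ring
    rw [key, hc, hs, Real.cos_add, Real.cos_sub, Real.sin_add, Real.sin_sub]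
    linear_combination (Real.cos h * (1 / α ^ 2 - 1 / β ^ 2)) * (Real.sin_sq_add_cos_sq c)
  have e2 : ε * Real.sin (θ - c) = Real.sin h * (1 / α ^ 2 + 1 / β ^ 2) := by
    have key : ε * Real.sin (θ - c) = (ε * Real.sin θ) * Real.cos c - (ε * Real.cos θ) * Real.sin c := by
      rw [Real.sin_sub]; ring
    rw [key, hc, hs, Real.cos_add, Real.cos_sub, Real.sin_add, Real.sin_sub]
    linear_combination (Real.sin h * (1 / α ^ 2 + 1 / β ^ 2)) * (Real.sin_sq_add_cos_sq c)
  have cθ : 0 < Real.cos (θ - c) := by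
    have : 0 < ε * Real.cos (θ - c) := by
      rw [e1]; exact mul_pos ch (by linarith)
    exact (pos_iff_pos_of_mul_pos this).1 hε
  have sθ : 0 < Real.sin (θ - c) := by
    have : 0 < ε * Real.sin (θ - c) := by
      rw [e2]; positivity
    exact (pos_iff_pos_of_mul_pos this).1 hε
  have hθc0 : 0 < θ - c := by
    by_contra hle
    push Not at hle
    exact absurd sθ (not_lt.2 (Real.sin_nonpos_of_nonpos_of_neg_pi_le hle (by linarith)))
  have hθc1 : θ - c < Real.pi / 2 := by
    by_contra hle
    push Not at hle
    exact absurd cθ (not_lt.2 (Real.cos_nonpos_of_pi_div_two_le_of_le hle (by linarith)))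
  -- the relation between the tangents
  have hα' : α * (Real.sin h * Real.cos h) = Real.sin (c - h) := by
    have : α * Real.sin (c + h - (c - h)) = 2 * Real.sin (c - h) := by
      rw [Real.sin_sub (c + h)]
      linear_combination Real.cos (c - h) * hy + Real.sin (c - h) * hx
    rw [show c + h - (c - h) = 2 * h by ring, Real.sin_two_mul] at this
    linarith
  have hβ' : β * (Real.sin h * Real.cos h) = Real.sin (c + h) := by
    have : β * Real.sin (c + h - (c - h)) = 2 * Real.sin (c + h) := by
      rw [Real.sin_sub (c + h)]
      linear_combination Real.cos (c + h) * hy + Real.sin (c + h) * hx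
    rw [show c + h - (c - h) = 2 * h by ring, Real.sin_two_mul] at this
    linarith
  have shn := sh.ne'
  have chn := ch.ne'
  have scn := sc.ne'
  have ccn := cc.ne'
  have cθn := cθ.ne'
  -- Dividing the two projections removes `ε`; the sine rule `hα'`, `hβ'` turns lengths into sines.
  have e3 : 2 * Real.sin (θ - c) * (Real.sin c * Real.cos c * Real.cos h ^ 2) =
      Real.cos (θ - c) * (Real.sin c ^ 2 * Real.cos h ^ 2 + Real.cos c ^ 2 * Real.sin h ^ 2) := by
    have f1 : ε * α ^ 2 * β ^ 2 * Real.cos (θ - c) = Real.cos h * (β ^ 2 - α ^ 2) := by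
      have := congrArg (fun z => z * (α ^ 2 * β ^ 2)) e1
      field_simp at this
      linarith
    have f2 : ε * α ^ 2 * β ^ 2 * Real.sin (θ - c) = Real.sin h * (β ^ 2 + α ^ 2) := by
      have := congrArg (fun z => z * (α ^ 2 * β ^ 2)) e2
      field_simp at this
      linarith
    have f3 : Real.cos h * (β ^ 2 - α ^ 2) * Real.sin (θ - c) =
        Real.sin h * (β ^ 2 + α ^ 2) * Real.cos (θ - c) := by
      rw [← f1, ← f2]; ring
    have f4 : Real.cos h * (Real.sin (c + h) ^ 2 - Real.sin (c - h) ^ 2) * Real.sin (θ - c) =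
        Real.sin h * (Real.sin (c + h) ^ 2 + Real.sin (c - h) ^ 2) * Real.cos (θ - c) := by
      rw [← hα', ← hβ']
      linear_combination (Real.sin h * Real.cos h) ^ 2 * f3
    rw [Real.sin_add, Real.sin_sub] at f4
    have : Real.sin h * (2 * Real.sin (θ - c) * (Real.sin c * Real.cos c * Real.cos h ^ 2)) =
      Real.sin h * (Real.cos (θ - c) *
        (Real.sin c ^ 2 * Real.cos h ^ 2 + Real.cos c ^ 2 * Real.sin h ^ 2)) := by
      linear_combination f4 / 2
    exact mul_left_cancel₀ shn this
  have htan : Real.tan h ^ 2 = Real.tan c * (2 * Real.tan (θ - c) - Real.tan c) := by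
    rw [Real.tan_eq_sin_div_cos, Real.tan_eq_sin_div_cos, Real.tan_eq_sin_div_cos]
    field_simp
    linear_combination -e3
  have sw : Real.sin (2 * c - θ) =
      Real.sin c * Real.cos (θ - c) - Real.cos c * Real.sin (θ - c) := by
    rw [← Real.sin_sub]; congr 1; ring
  -- The left side is positive, which forces `2 * c - θ > 0`.
  have hprod : Real.sin (c + h) * Real.sin (c - h) * Real.cos (θ - c) =
      2 * Real.cos h ^ 2 * Real.sin c * Real.sin (2 * c - θ) := by
    rw [sw, Real.sin_add, Real.sin_sub]
    linear_combination e3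
  have hwpos : 0 < Real.sin (2 * c - θ) := by
    have h1 : 0 < 2 * Real.cos h ^ 2 * Real.sin c * Real.sin (2 * c - θ) := by
      rw [← hprod]; positivity
    exact (pos_iff_pos_of_mul_pos h1).1 (by positivity)
  have hlt2 : θ - c < c := by
    by_contra hle
    push Not at hle
    exact absurd hwpos (not_lt.2 (Real.sin_nonpos_of_nonpos_of_neg_pi_le (by linarith) (by linarith)))
  refine ⟨c, h, rfl, rfl, hh0, hhc, hcpi2, hθc0, hlt2, htan, ?_⟩
  have f1 : ε * α ^ 2 * β ^ 2 * Real.cos (θ - c) = Real.cos h * (β ^ 2 - α ^ 2) := by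
    have := congrArg (fun z => z * (α ^ 2 * β ^ 2)) e1
    field_simp at this
    linarith
  have f5 : ε * (Real.sin (c + h) * Real.sin (c - h)) ^ 2 * Real.cos (θ - c) =
      4 * Real.cos h ^ 4 * Real.sin h ^ 3 * (Real.sin c * Real.cos c) := by
    have f6 : Real.sin (c + h) ^ 2 - Real.sin (c - h) ^ 2 =
        4 * Real.sin c * Real.cos c * (Real.sin h * Real.cos h) := by
      rw [Real.sin_add, Real.sin_sub]; ring
    have f7 : ε * (Real.sin (c + h) * Real.sin (c - h)) ^ 2 * Real.cos (θ - c) =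
        (Real.sin h * Real.cos h) ^ 2 * Real.cos h *
          (Real.sin (c + h) ^ 2 - Real.sin (c - h) ^ 2) := by
      rw [← hα', ← hβ']
      linear_combination (Real.sin h * Real.cos h) ^ 4 * f1
    rw [f7, f6]; ring
  have f8 : (4 * Real.cos h ^ 4 * Real.sin c) *
      (ε * (Real.sin c * Real.sin (2 * c - θ) ^ 2)) =
      (4 * Real.cos h ^ 4 * Real.sin c) *
        (Real.sin h ^ 3 * (Real.cos (θ - c) * Real.cos c)) := by
    have : ε * (Real.sin (c + h) * Real.sin (c - h) * Real.cos (θ - c)) ^ 2 =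
      4 * Real.cos h ^ 4 * Real.sin h ^ 3 * (Real.sin c * Real.cos c) * Real.cos (θ - c) := by
      linear_combination Real.cos (θ - c) * f5
    rw [hprod] at this
    linear_combination this
  exact mul_left_cancel₀ (by positivity) f8

/-- For fixed `θ`, the tangent relation makes `h` decrease as `c` grows. In the strength relation a
larger `c` then raises the left side and lowers the right side. -/
theorem bisector_angle_not_lt {θ ε c h c' h' : ℝ}
    (hh' : 0 < h') (hhc : h < c) (hh : 0 < h) (hh'c' : h' < c') (hc : c < Real.pi / 2) (hc' : c' < Real.pi / 2)
    (hθc : θ - c < c) (hθc' : 0 < θ - c') (hε : 0 < ε)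
    (ht : Real.tan h ^ 2 = Real.tan c * (2 * Real.tan (θ - c) - Real.tan c))
    (ht' : Real.tan h' ^ 2 = Real.tan c' * (2 * Real.tan (θ - c') - Real.tan c'))
    (he : ε * (Real.sin c * Real.sin (2 * c - θ) ^ 2) =
        Real.sin h ^ 3 * (Real.cos (θ - c) * Real.cos c))
    (he' : ε * (Real.sin c' * Real.sin (2 * c' - θ) ^ 2) =
        Real.sin h' ^ 3 * (Real.cos (θ - c') * Real.cos c')) : ¬ c < c' := by
  intro hlt
  have T1 : Real.tan c < Real.tan c' := Real.tan_lt_tan_of_lt_of_lt_pi_div_two (by linarith) hc' hlt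
  have T2 : Real.tan (θ - c') < Real.tan (θ - c) :=
    Real.tan_lt_tan_of_lt_of_lt_pi_div_two (by linarith) (by linarith) (by linarith)
  have T3 : Real.tan (θ - c) < Real.tan c :=
    Real.tan_lt_tan_of_lt_of_lt_pi_div_two (by linarith) hc hθc
  have T0 : 0 < Real.tan c := Real.tan_pos_of_pos_of_lt_pi_div_two (by linarith) hc
  have Hsq : Real.tan h' ^ 2 < Real.tan h ^ 2 := by
    rw [ht, ht']
    nlinarith [mul_pos T0 (sub_pos.2 T2),
      mul_pos (sub_pos.2 T1) (show 0 < Real.tan c + Real.tan c' - 2 * Real.tan (θ - c') by linarith)]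
  have Hpos : 0 < Real.tan h := Real.tan_pos_of_pos_of_lt_pi_div_two hh (by linarith)
  have Hlt : Real.tan h' < Real.tan h := lt_of_pow_lt_pow_left₀ 2 Hpos.le Hsq
  have hlt' : h' < h := by
    by_contra hle
    push Not at hle
    rcases hle.lt_or_eq with h1 | h1
    · exact absurd (Real.tan_lt_tan_of_lt_of_lt_pi_div_two (by linarith) (by linarith) h1)
        (not_lt.2 Hlt.le)
    · rw [h1] at Hlt; exact lt_irrefl _ Hlt
  have s1 : 0 < Real.sin h' := Real.sin_pos_of_pos_of_lt_pi hh' (by linarith)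
  have s2 : Real.sin h' < Real.sin h := Real.sin_lt_sin_of_lt_of_le_pi_div_two (by linarith) (by linarith) hlt'
  have s3 : 0 < Real.sin c := Real.sin_pos_of_pos_of_lt_pi (by linarith) (by linarith)
  have s4 : Real.sin c < Real.sin c' := Real.sin_lt_sin_of_lt_of_le_pi_div_two (by linarith) (by linarith) hlt
  have s5 : 0 < Real.sin (2 * c - θ) := Real.sin_pos_of_pos_of_lt_pi (by linarith) (by linarith)
  have s6 : Real.sin (2 * c - θ) < Real.sin (2 * c' - θ) :=
    Real.sin_lt_sin_of_lt_of_le_pi_div_two (by linarith) (by linarith) (by linarith)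
  have c1 : Real.cos (2 * c' - θ) < Real.cos (2 * c - θ) :=
    Real.cos_lt_cos_of_nonneg_of_le_pi (by linarith) (by linarith) (by linarith)
  -- Product to sum: the product depends on `z` only through `2 * z - θ`, where the cosine is
  -- monotone.
  have c2 (z : ℝ) : 2 * (Real.cos (θ - z) * Real.cos z) = Real.cos θ + Real.cos (2 * z - θ) := by
    have : Real.cos (2 * z - θ) = Real.cos (z - (θ - z)) := by congr 1; ring
    rw [this, Real.cos_sub z]
    conv_rhs => rw [show Real.cos θ = Real.cos ((θ - z) + z) by ring_nf, Real.cos_add]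
    ring
  have c3 : Real.cos (θ - c') * Real.cos c' < Real.cos (θ - c) * Real.cos c := by
    linarith [c2 c, c2 c']
  have c4 : 0 < Real.cos (θ - c') * Real.cos c' :=
    mul_pos (Real.cos_pos_of_mem_Ioo ⟨by linarith, by linarith⟩)
      (Real.cos_pos_of_mem_Ioo ⟨by linarith, by linarith⟩)
  have L : ε * (Real.sin c * Real.sin (2 * c - θ) ^ 2) <
      ε * (Real.sin c' * Real.sin (2 * c' - θ) ^ 2) := by gcongr
  have R : Real.sin h' ^ 3 * (Real.cos (θ - c') * Real.cos c') <
      Real.sin h ^ 3 * (Real.cos (θ - c) * Real.cos c) := by gcongr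
  linarith

theorem bisector_angles_unique {θ ε c h c' h' : ℝ}
    (hh' : 0 < h') (hhc : h < c) (hh : 0 < h) (hh'c' : h' < c') (hc : c < Real.pi / 2) (hc' : c' < Real.pi / 2)
    (hθc0 : 0 < θ - c) (hθc : θ - c < c) (hθc' : 0 < θ - c') (hθc'' : θ - c' < c') (hε : 0 < ε)
    (ht : Real.tan h ^ 2 = Real.tan c * (2 * Real.tan (θ - c) - Real.tan c))
    (ht' : Real.tan h' ^ 2 = Real.tan c' * (2 * Real.tan (θ - c') - Real.tan c'))
    (he : ε * (Real.sin c * Real.sin (2 * c - θ) ^ 2) =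
        Real.sin h ^ 3 * (Real.cos (θ - c) * Real.cos c))
    (he' : ε * (Real.sin c' * Real.sin (2 * c' - θ) ^ 2) =
        Real.sin h' ^ 3 * (Real.cos (θ - c') * Real.cos c')) : c = c' ∧ h = h' := by
  have hcc : c = c' := le_antisymm
    (not_lt.1 (bisector_angle_not_lt hh hh'c' hh' hhc hc' hc hθc'' hθc0 hε ht' ht he' he))
    (not_lt.1 (bisector_angle_not_lt hh' hhc hh hh'c' hc hc' hθc hθc' hε ht ht' he he'))
  subst hcc
  refine ⟨rfl, ?_⟩
  have Hpos : 0 < Real.tan h := Real.tan_pos_of_pos_of_lt_pi_div_two hh (by linarith)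
  have Hpos' : 0 < Real.tan h' := Real.tan_pos_of_pos_of_lt_pi_div_two hh' (by linarith)
  have : Real.tan h = Real.tan h' := by
    rw [← ht'] at ht
    exact (pow_left_inj₀ Hpos.le Hpos'.le two_ne_zero).1 ht
  exact Real.injOn_tan ⟨by linarith, by linarith⟩ ⟨by linarith, by linarith⟩ this

/-! ### The dipole field in the complex plane -/

/-- The planar field of two opposite unit charges placed at `1` and `-1`. -/
noncomputable def dipoleField (z : ℂ) : ℂ :=
  (‖1 - z‖ ^ 3)⁻¹ • (1 - z) + (‖1 + z‖ ^ 3)⁻¹ • (1 + z)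

theorem dipoleField_neg (z : ℂ) : dipoleField (-z) = dipoleField z := by
  simp only [dipoleField, sub_neg_eq_add, ← sub_eq_add_neg]
  exact add_comm _ _

theorem dipoleField_conj (z : ℂ) :
    dipoleField (starRingEnd ℂ z) = starRingEnd ℂ (dipoleField z) := by
  have h1 : ‖1 - starRingEnd ℂ z‖ = ‖1 - z‖ := by
    rw [← Complex.norm_conj (1 - z)]; simp
  have h2 : ‖1 + starRingEnd ℂ z‖ = ‖1 + z‖ := by
    rw [← Complex.norm_conj (1 + z)]; simp
  simp only [dipoleField, h1, h2, Complex.real_smul, map_add, map_sub, map_mul, map_one,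
    Complex.conj_ofReal]

theorem dipoleField_re (z : ℂ) : (dipoleField z).re =
    (‖1 - z‖ ^ 3)⁻¹ * (1 - z.re) + (‖1 + z‖ ^ 3)⁻¹ * (1 + z.re) := by
  simp only [dipoleField, Complex.add_re, Complex.smul_re, Complex.sub_re, Complex.one_re,
    smul_eq_mul]

theorem dipoleField_im (z : ℂ) : (dipoleField z).im =
    z.im * ((‖1 + z‖ ^ 3)⁻¹ - (‖1 - z‖ ^ 3)⁻¹) := by
  simp only [dipoleField, Complex.add_im, Complex.smul_im, Complex.sub_im, Complex.one_im,
    smul_eq_mul]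
  ring

theorem norm_one_sub_sq (z : ℂ) : ‖1 - z‖ ^ 2 = (1 - z.re) ^ 2 + z.im ^ 2 := by
  rw [Complex.sq_norm, Complex.normSq_apply]; simp; ring

theorem norm_one_add_sq (z : ℂ) : ‖1 + z‖ ^ 2 = (1 + z.re) ^ 2 + z.im ^ 2 := by
  rw [Complex.sq_norm, Complex.normSq_apply]; simp; ring

theorem arg_mem_Ioo_of_im_pos {z : ℂ} (hz : 0 < z.im) : z.arg ∈ Set.Ioo 0 Real.pi := by
  have h := Complex.norm_mul_sin_arg z
  have hs : 0 < Real.sin z.arg := by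
    by_contra hle
    push Not at hle
    nlinarith [norm_nonneg z]
  refine ⟨?_, ?_⟩
  · by_contra hle
    push Not at hle
    exact absurd hs
      (not_lt.2 (Real.sin_nonpos_of_nonpos_of_neg_pi_le hle (Complex.neg_pi_lt_arg z).le))
  · refine lt_of_le_of_ne (Complex.arg_le_pi z) fun he => ?_
    rw [he, Real.sin_pi] at hs
    exact lt_irrefl _ hs

/-- In the open first quadrant the field points into the lower half-plane, so its opposite is used
to get an argument in `(0, π)`. -/
theorem dipoleField_angles {z : ℂ} (hu : 0 < z.re) (hv : 0 < z.im) :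
    ∃ c h : ℝ, (z - 1).arg = c + h ∧ (z + 1).arg = c - h ∧ 0 < h ∧ h < c ∧ c < Real.pi / 2 ∧
      0 < (-dipoleField z).arg - c ∧ (-dipoleField z).arg - c < c ∧ 0 < ‖-dipoleField z‖ ∧
      Real.tan h ^ 2 =
        Real.tan c * (2 * Real.tan ((-dipoleField z).arg - c) - Real.tan c) ∧
      ‖-dipoleField z‖ * (Real.sin c * Real.sin (2 * c - (-dipoleField z).arg) ^ 2) =
        Real.sin h ^ 3 * (Real.cos ((-dipoleField z).arg - c) * Real.cos c) := by
  have hα2 : ‖z - 1‖ ^ 2 = (1 - z.re) ^ 2 + z.im ^ 2 := by rw [norm_sub_rev, norm_one_sub_sq]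
  have hβ2 : ‖z + 1‖ ^ 2 = (1 + z.re) ^ 2 + z.im ^ 2 := by rw [add_comm z, norm_one_add_sq]
  have hα : 0 < ‖z - 1‖ := by
    refine lt_of_le_of_ne (norm_nonneg _) fun h => ?_
    rw [← h] at hα2
    nlinarith [sq_nonneg (1 - z.re)]
  have hαβ : ‖z - 1‖ < ‖z + 1‖ := by
    refine lt_of_pow_lt_pow_left₀ 2 (norm_nonneg _) ?_
    rw [hα2, hβ2]; nlinarith
  have hσ : (z - 1).arg ∈ Set.Ioo 0 Real.pi := arg_mem_Ioo_of_im_pos (by simpa using hv)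
  have hτ : (z + 1).arg ∈ Set.Ioo 0 Real.pi := arg_mem_Ioo_of_im_pos (by simpa using hv)
  have c1 := Complex.norm_mul_cos_arg (z - 1)
  have s1 := Complex.norm_mul_sin_arg (z - 1)
  have c2 := Complex.norm_mul_cos_arg (z + 1)
  have s2 := Complex.norm_mul_sin_arg (z + 1)
  simp only [Complex.sub_re, Complex.sub_im, Complex.add_re, Complex.add_im, Complex.one_re,
    Complex.one_im, sub_zero, add_zero] at c1 s1 c2 s2
  have hβ := hα.trans hαβ
  have hY : 0 < (-dipoleField z).im := by
    rw [Complex.neg_im, dipoleField_im, add_comm 1 z, norm_sub_rev 1 z]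
    have : (‖z + 1‖ ^ 3)⁻¹ < (‖z - 1‖ ^ 3)⁻¹ := by gcongr
    nlinarith
  have hθ := arg_mem_Ioo_of_im_pos hY
  have hε : 0 < ‖-dipoleField z‖ := by
    rw [norm_pos_iff]; intro h; rw [h] at hY; simp at hY
  have hτσ : (z + 1).arg < (z - 1).arg := by
    have : ‖z - 1‖ * ‖z + 1‖ * Real.sin ((z - 1).arg - (z + 1).arg) = 2 * z.im := by
      rw [Real.sin_sub]
      linear_combination (‖z + 1‖ * Real.cos (z + 1).arg) * s1 + z.im * c2
        - (‖z + 1‖ * Real.sin (z + 1).arg) * c1 - (z.re - 1) * s2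
    by_contra hle
    push Not at hle
    have hs := Real.sin_nonpos_of_nonpos_of_neg_pi_le (x := (z - 1).arg - (z + 1).arg)
      (by linarith) (by linarith [hτ.2, hσ.1])
    have : ‖z - 1‖ * ‖z + 1‖ * Real.sin ((z - 1).arg - (z + 1).arg) ≤ 0 :=
      mul_nonpos_of_nonneg_of_nonpos (by positivity) hs
    linarith
  obtain ⟨c, h, e1, e2, p1, p2, p3, p4, p5, p6, p7⟩ :=
    dipole_angle_relations (σ := (z - 1).arg) (τ := (z + 1).arg) (θ := (-dipoleField z).arg)
      (α := ‖z - 1‖) (β := ‖z + 1‖) (ε := ‖-dipoleField z‖) hτ.1 hσ.2 hθ.1 hθ.2 hτσ hα hαβ hε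
      (by rw [s1, s2]) (by rw [c1, c2]; ring)
      (by
        rw [Complex.norm_mul_cos_arg, Complex.neg_re, dipoleField_re, add_comm 1 z,
          norm_sub_rev 1 z]
        field_simp
        linear_combination -‖z + 1‖ ^ 3 * c1 + ‖z - 1‖ ^ 3 * c2)
      (by
        rw [Complex.norm_mul_sin_arg, Complex.neg_im, dipoleField_im, add_comm 1 z,
          norm_sub_rev 1 z]
        field_simp
        linear_combination -‖z + 1‖ ^ 3 * s1 + ‖z - 1‖ ^ 3 * s2)
  exact ⟨c, h, e1, e2, p1, p2, p3, p4, p5, hε, p6, p7⟩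

/-- A triangle is determined by its base and the two base angles (sine rule). -/
theorem eq_of_arg_sub_one_eq_of_arg_add_one_eq {z w : ℂ} (hz : 0 < z.im)
    (h1 : (z - 1).arg = (w - 1).arg) (h2 : (z + 1).arg = (w + 1).arg) : z = w := by
  have key (z : ℂ) :
      ‖z - 1‖ * Real.sin ((z - 1).arg - (z + 1).arg) = 2 * Real.sin (z + 1).arg := by
    have c1 := Complex.norm_mul_cos_arg (z - 1)
    have s1 := Complex.norm_mul_sin_arg (z - 1)
    have c2 := Complex.norm_mul_cos_arg (z + 1)
    have s2 := Complex.norm_mul_sin_arg (z + 1)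
    simp only [Complex.sub_re, Complex.sub_im, Complex.add_re, Complex.add_im, Complex.one_re,
      Complex.one_im, sub_zero, add_zero] at c1 s1 c2 s2
    rw [Real.sin_sub]
    linear_combination Real.cos (z + 1).arg * (s1 - s2) - Real.sin (z + 1).arg * (c1 - c2)
  have hs : 0 < Real.sin (z + 1).arg := by
    have := arg_mem_Ioo_of_im_pos (z := z + 1) (by simpa using hz)
    exact Real.sin_pos_of_pos_of_lt_pi this.1 this.2
  have kz := key z
  have kw := key w
  rw [← h1, ← h2] at kw
  have hne : Real.sin ((z - 1).arg - (z + 1).arg) ≠ 0 := by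
    intro h0
    rw [h0] at kz
    linarith
  have hn : ‖z - 1‖ = ‖w - 1‖ := mul_right_cancel₀ hne (kz.trans kw.symm)
  have := Complex.ext_norm_arg hn h1
  exact sub_left_injective this

theorem dipoleField_injOn_quadrant {z w : ℂ} (hz : 0 < z.re) (hz' : 0 < z.im) (hw : 0 < w.re)
    (hw' : 0 < w.im) (h : dipoleField z = dipoleField w) : z = w := by
  obtain ⟨c, k, e1, e2, p1, p2, p3, p4, p5, hε, p6, p7⟩ := dipoleField_angles hz hz'
  obtain ⟨c', k', e1', e2', p1', p2', p3', p4', p5', -, p6', p7'⟩ := dipoleField_angles hw hw'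
  rw [← h] at p4' p5' p6' p7'
  obtain ⟨rfl, rfl⟩ := bisector_angles_unique p1' p2 p1 p2' p3 p3' p4 p5 p4' p5' hε p6 p6' p7 p7'
  exact eq_of_arg_sub_one_eq_of_arg_add_one_eq hz' (e1.trans e1'.symm) (e2.trans e2'.symm)

/-! ### The axes, and injectivity up to point reflection -/

theorem norm_one_add_eq_iff {z : ℂ} : ‖1 + z‖ = ‖1 - z‖ ↔ z.re = 0 := by
  rw [← pow_left_inj₀ (norm_nonneg _) (norm_nonneg _) two_ne_zero, norm_one_add_sq,
    norm_one_sub_sq]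
  constructor <;> intro h <;> nlinarith

theorem dipoleField_im_eq_zero {z : ℂ} (hz1 : z ≠ 1) (hz2 : z ≠ -1) :
    (dipoleField z).im = 0 ↔ z.im = 0 ∨ z.re = 0 := by
  have h1 : 0 < ‖1 - z‖ := norm_pos_iff.2 (sub_ne_zero.2 hz1.symm)
  have h2 : 0 < ‖1 + z‖ := norm_pos_iff.2 fun h => hz2 (by linear_combination h)
  rw [dipoleField_im, mul_eq_zero, sub_eq_zero, inv_inj,
    pow_left_inj₀ h2.le h1.le three_ne_zero, norm_one_add_eq_iff]

theorem dipoleField_re_of_re_eq_zero {z : ℂ} (hz : z.re = 0) :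
    (dipoleField z).re = 2 * (‖1 - z‖ ^ 3)⁻¹ := by
  rw [dipoleField_re, norm_one_add_eq_iff.2 hz, hz]; ring

theorem dipoleField_re_of_im_eq_zero {z : ℂ} (hz : z.im = 0) (hz1 : z ≠ 1) (hz2 : z ≠ -1) :
    (dipoleField z).re < 0 ∨ 2 ≤ (dipoleField z).re := by
  have aux (u : ℝ) (hu : u ≠ 0) : (|u| ^ 3)⁻¹ * u = (u * |u|)⁻¹ := by
    have : |u| ≠ 0 := abs_ne_zero.2 hu
    have h2 : |u| * |u| = u * u := abs_mul_abs_self u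
    field_simp
    linear_combination -h2
  have h1 : 1 - z.re ≠ 0 := fun h => hz1 (Complex.ext (by simp; linarith) (by simpa using hz))
  have h2 : 1 + z.re ≠ 0 := fun h => hz2 (Complex.ext (by simp; linarith) (by simpa using hz))
  have n1 : ‖1 - z‖ = |1 - z.re| := by
    rw [← pow_left_inj₀ (norm_nonneg _) (abs_nonneg _) two_ne_zero, norm_one_sub_sq, hz, sq_abs]
    ring
  have n2 : ‖1 + z‖ = |1 + z.re| := by
    rw [← pow_left_inj₀ (norm_nonneg _) (abs_nonneg _) two_ne_zero, norm_one_add_sq, hz, sq_abs]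
    ring
  rw [dipoleField_re, n1, n2, aux _ h1, aux _ h2]
  generalize z.re = u at *
  rcases lt_or_gt_of_ne h1 with g1 | g1
  · left
    rw [abs_of_neg g1, abs_of_pos (by linarith : 0 < 1 + u)]
    have : ((1 + u) * (1 + u))⁻¹ < ((u - 1) * (u - 1))⁻¹ := by
      apply inv_strictAnti₀ <;> nlinarith
    have e : ((1 - u) * -(1 - u))⁻¹ = -((u - 1) * (u - 1))⁻¹ := by
      rw [← inv_neg]; congr 1; ring
    rw [e]; linarith
  rcases lt_or_gt_of_ne h2 with g2 | g2
  · left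
    rw [abs_of_neg g2, abs_of_pos g1]
    have : ((1 - u) * (1 - u))⁻¹ < ((-u - 1) * (-u - 1))⁻¹ := by
      apply inv_strictAnti₀ <;> nlinarith
    have e : ((1 + u) * -(1 + u))⁻¹ = -((-u - 1) * (-u - 1))⁻¹ := by
      rw [← inv_neg]; congr 1; ring
    rw [e]; linarith
  · right
    rw [abs_of_pos g2, abs_of_pos g1, inv_eq_one_div, inv_eq_one_div,
      div_add_div _ _ (by positivity) (by positivity), le_div_iff₀ (by positivity)]
    nlinarith [sq_nonneg u, mul_nonneg (sq_nonneg u) (mul_pos g1 g2).le]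

/-- A real field value off the real axis occurs only on the imaginary axis, where it lies strictly
between `0` and `2`; on the real axis the values are negative or at least `2`. -/
theorem not_dipoleField_eq_of_im_eq_zero {z w : ℂ} (hw1 : w ≠ 1) (hw2 : w ≠ -1) (hw : w.im = 0)
    (hz : z.im ≠ 0) : dipoleField z ≠ dipoleField w := by
  intro h
  have hz1 : z ≠ 1 := by rintro rfl; simp at hz
  have hz2 : z ≠ -1 := by rintro rfl; simp at hz
  have hz0 : z.re = 0 := by
    refine ((dipoleField_im_eq_zero hz1 hz2).1 ?_).resolve_left hz
    rw [h]; exact (dipoleField_im_eq_zero hw1 hw2).2 (Or.inl hw)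
  have hn : 1 < ‖1 - z‖ := by
    refine lt_of_pow_lt_pow_left₀ 2 (norm_nonneg _) ?_
    rw [norm_one_sub_sq, hz0]
    have := sq_pos_of_ne_zero hz
    linarith
  have e := dipoleField_re_of_re_eq_zero hz0
  have l : (‖1 - z‖ ^ 3)⁻¹ < 1 := inv_lt_one_of_one_lt₀ (one_lt_pow₀ hn three_ne_zero)
  have l0 : 0 < (‖1 - z‖ ^ 3)⁻¹ := by positivity
  rcases dipoleField_re_of_im_eq_zero hw hw1 hw2 with g | g <;> rw [← h] at g <;> linarith

theorem dipoleField_injOn_right {z w : ℂ} (hz : 0 < z.re) (hz' : z.im ≠ 0) (hw : 0 < w.re)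
    (h : dipoleField z = dipoleField w) : z = w := by
  have sgn {z : ℂ} (hz : 0 < z.re) (hz' : z.im ≠ 0) :
      (‖1 + z‖ ^ 3)⁻¹ < (‖1 - z‖ ^ 3)⁻¹ := by
    have h1 : 0 < ‖1 - z‖ := by
      rw [norm_pos_iff, sub_ne_zero]; rintro rfl; simp at hz'
    have h2 : ‖1 - z‖ < ‖1 + z‖ := by
      refine lt_of_pow_lt_pow_left₀ 2 (norm_nonneg _) ?_
      rw [norm_one_add_sq, norm_one_sub_sq]; linarith
    gcongr
  by_cases hw' : w.im = 0
  · by_cases h1 : w = 1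
    · subst h1
      have hi := congrArg Complex.im h
      rw [dipoleField_im, dipoleField_im 1, Complex.one_im, zero_mul] at hi
      exact absurd hi (mul_ne_zero hz' (sub_ne_zero.2 (sgn hz hz').ne))
    · have h2 : w ≠ -1 := by
        rintro rfl
        norm_num at hw
      exact absurd h (not_dipoleField_eq_of_im_eq_zero h1 h2 hw' hz')
  have hi := congrArg Complex.im h
  rw [dipoleField_im, dipoleField_im] at hi
  have s1 := sgn hz hz'
  have s2 := sgn hw hw'
  rcases lt_or_gt_of_ne hz' with g | g
  · have g' : w.im < 0 := by
      by_contra hle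
      push Not at hle
      nlinarith [mul_nonneg hle (sub_nonneg.2 s2.le), mul_pos (neg_pos.2 g) (sub_pos.2 s1)]
    have := dipoleField_injOn_quadrant (z := starRingEnd ℂ z) (w := starRingEnd ℂ w)
      (by simpa using hz) (by simpa using g) (by simpa using hw) (by simpa using g')
      (by rw [dipoleField_conj, dipoleField_conj, h])
    exact (starRingEnd ℂ).injective this
  · have g' : 0 < w.im := by
      by_contra hle
      push Not at hle
      nlinarith [mul_nonneg (neg_nonneg.2 hle) (sub_nonneg.2 s2.le), mul_pos g (sub_pos.2 s1)]
    exact dipoleField_injOn_quadrant hz g hw g' h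

theorem eq_or_eq_neg_of_dipoleField_eq {z w : ℂ} (hz' : z.im ≠ 0) (hw1 : w ≠ 1) (hw2 : w ≠ -1)
    (h : dipoleField z = dipoleField w) : z = w ∨ z = -w := by
  have hw' : w.im ≠ 0 := fun h0 => not_dipoleField_eq_of_im_eq_zero hw1 hw2 h0 hz' h
  have hz1 : z ≠ 1 := by rintro rfl; simp at hz'
  have hz2 : z ≠ -1 := by rintro rfl; simp at hz'
  by_cases hz0 : z.re = 0
  · have hw0 : w.re = 0 := by
      refine ((dipoleField_im_eq_zero hw1 hw2).1 ?_).resolve_left hw'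
      rw [← h]; exact (dipoleField_im_eq_zero hz1 hz2).2 (Or.inr hz0)
    have hr := congrArg Complex.re h
    rw [dipoleField_re_of_re_eq_zero hz0, dipoleField_re_of_re_eq_zero hw0,
      mul_right_inj' two_ne_zero, inv_inj,
      pow_left_inj₀ (norm_nonneg _) (norm_nonneg _) three_ne_zero,
      ← pow_left_inj₀ (norm_nonneg _) (norm_nonneg _) two_ne_zero, norm_one_sub_sq,
      norm_one_sub_sq, hz0, hw0, add_right_inj, sq_eq_sq_iff_eq_or_eq_neg] at hr
    rcases hr with hr | hr
    · left; exact Complex.ext (hz0.trans hw0.symm) hr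
    · right; exact Complex.ext (by simp [hz0, hw0]) (by simpa using hr)
  have hw0 : w.re ≠ 0 := fun h0 => by
    have := (dipoleField_im_eq_zero hz1 hz2).1
      (by rw [h]; exact (dipoleField_im_eq_zero hw1 hw2).2 (Or.inr h0))
    tauto
  rcases lt_or_gt_of_ne hz0 with g | g <;> rcases lt_or_gt_of_ne hw0 with g' | g'
  · left
    have := dipoleField_injOn_right (z := -z) (w := -w) (by simpa using g) (by simpa using hz')
      (by simpa using g') (by rw [dipoleField_neg, dipoleField_neg, h])
    exact neg_injective this
  · right
    have := dipoleField_injOn_right (z := -z) (w := w) (by simpa using g) (by simpa using hz')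
      g' (by rw [dipoleField_neg, h])
    rw [← this, neg_neg]
  · right
    exact dipoleField_injOn_right (z := z) (w := -w) g hz'
      (by simpa using g') (by rw [dipoleField_neg, h])
  · left
    exact dipoleField_injOn_right g hz' g' h

/-- The similarity sending the midpoint to `0` and `A, B` to `1, -1` multiplies the field by a
constant, which reduces the claim to `dipoleField`. -/
theorem two_centre_field_injective {A B z w : ℂ} (hAB : A ≠ B) (hzA : z ≠ A) (hzB : z ≠ B)
    (hwA : w ≠ A) (hwB : w ≠ B)
    (h : (‖A - z‖ ^ 3)⁻¹ • (A - z) - (‖B - z‖ ^ 3)⁻¹ • (B - z) =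
      (‖A - w‖ ^ 3)⁻¹ • (A - w) - (‖B - w‖ ^ 3)⁻¹ • (B - w)) :
    z = w ∨ z + w = A + B ∨
      ∃ s t : ℝ, z = B + s • (A - B) ∧ w = B + t • (A - B) := by
  obtain ⟨k, hk⟩ : ∃ k, k = (A - B) / 2 := ⟨_, rfl⟩
  have hk0 : k ≠ 0 := by
    rw [hk]; exact div_ne_zero (sub_ne_zero.2 hAB) two_ne_zero
  obtain rfl : A = B + 2 * k := by rw [hk]; ring
  clear hk
  have e1 (z : ℂ) : 1 - (z - (B + k)) / k = (B + 2 * k - z) / k := by field_simp; ring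
  have e2 (z : ℂ) : 1 + (z - (B + k)) / k = -(B - z) / k := by field_simp; ring
  have field (z : ℂ) : dipoleField ((z - (B + k)) / k) =
      (‖k‖ ^ 3 / k : ℂ) * ((‖B + 2 * k - z‖ ^ 3)⁻¹ • (B + 2 * k - z) -
        (‖B - z‖ ^ 3)⁻¹ • (B - z)) := by
    rw [dipoleField, e1, e2, norm_div, norm_div, norm_neg, div_pow, div_pow, inv_div, inv_div]
    simp only [Complex.real_smul, Complex.ofReal_div, Complex.ofReal_pow, Complex.ofReal_inv]
    ring
  have ne1 {z : ℂ} (hz : z ≠ B + 2 * k) : (z - (B + k)) / k ≠ 1 := by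
    intro h0
    rw [div_eq_one_iff_eq hk0] at h0
    exact hz (by linear_combination h0)
  have ne2 {z : ℂ} (hz : z ≠ B) : (z - (B + k)) / k ≠ -1 := by
    intro h0
    rw [div_eq_iff hk0] at h0
    exact hz (by linear_combination h0)
  have hD : dipoleField ((z - (B + k)) / k) = dipoleField ((w - (B + k)) / k) := by
    rw [field, field, h]
  have concl {z w : ℂ} (h : (z - (B + k)) / k = (w - (B + k)) / k ∨
      (z - (B + k)) / k = -((w - (B + k)) / k)) : z = w ∨ z + w = B + 2 * k + B := by
    rcases h with h | h
    · left
      rw [div_left_inj' hk0] at h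
      exact sub_left_injective h
    · right
      rw [← neg_div, div_left_inj' hk0] at h
      linear_combination h
  by_cases hz : ((z - (B + k)) / k).im = 0
  · by_cases hw : ((w - (B + k)) / k).im = 0
    · right; right
      have real {z : ℂ} (hz : ((z - (B + k)) / k).im = 0) :
          z = B + (((((z - (B + k)) / k).re + 1) / 2 : ℝ)) • (B + 2 * k - B) := by
        have : (((z - (B + k)) / k).re : ℂ) = (z - (B + k)) / k :=
          Complex.ext (by simp) (by simp [hz])
        rw [Complex.real_smul]
        push_cast
        rw [this]
        field_simp
        ring
      exact ⟨_, _, real hz, real hw⟩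
    · rcases concl (eq_or_eq_neg_of_dipoleField_eq hw (ne1 hzA) (ne2 hzB) hD.symm) with g | g
      · exact Or.inl g.symm
      · exact Or.inr (Or.inl (by rw [add_comm]; exact g))
  · rcases concl (eq_or_eq_neg_of_dipoleField_eq hz (ne1 hwA) (ne2 hwB) hD) with g | g
    · exact Or.inl g
    · exact Or.inr (Or.inl g)

/-! ### Existence, uniqueness and ordering for the balance equations -/

/-- Parallelogram law and balance equations for a parallelogram with diagonals of lengths `ρ`, `μ`
carrying masses `x, -x` and `y, -y`, whose sides have lengths `α` (joining masses of product
`x * y`) and `β` (joining masses of product `-(x * y)`). -/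
def ParallelogramBalance (x y α β ρ μ : ℝ) : Prop :=
  (0 < α ∧ 0 < β ∧ 0 < ρ ∧ 0 < μ) ∧ ρ ^ 2 + μ ^ 2 = 2 * (α ^ 2 + β ^ 2) ∧
    2 * x * (ρ ^ 3)⁻¹ = (x + y) * (α ^ 3)⁻¹ + (x - y) * (β ^ 3)⁻¹ ∧
    2 * y * (μ ^ 3)⁻¹ = (x + y) * (α ^ 3)⁻¹ + (y - x) * (β ^ 3)⁻¹

namespace ParallelogramBalance

theorem flip {x y α β ρ μ : ℝ} (h : ParallelogramBalance x y α β ρ μ) :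
    ParallelogramBalance x (-y) β α ρ μ := by
  obtain ⟨⟨h1, h2, h3, h4⟩, h5, h6, h7⟩ := h
  exact ⟨⟨h2, h1, h3, h4⟩, by linarith, by linarith, by linarith⟩

theorem swap {x y α β ρ μ : ℝ} (h : ParallelogramBalance x y α β ρ μ) :
    ParallelogramBalance y x α β μ ρ := by
  obtain ⟨⟨h1, h2, h3, h4⟩, h5, h6, h7⟩ := h
  exact ⟨⟨h1, h2, h4, h3⟩, by linarith, by linarith, by linarith⟩

theorem scale {x y α β ρ μ k : ℝ} (hk : 0 < k) (h : ParallelogramBalance x y α β ρ μ) :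
    ParallelogramBalance x y (k * α) (k * β) (k * ρ) (k * μ) := by
  obtain ⟨⟨h1, h2, h3, h4⟩, h5, h6, h7⟩ := h
  refine ⟨⟨by positivity, by positivity, by positivity, by positivity⟩, ?_, ?_, ?_⟩
  · linear_combination k ^ 2 * h5
  · simp only [mul_pow, mul_inv]
    linear_combination (k ^ 3)⁻¹ * h6
  · simp only [mul_pow, mul_inv]
    linear_combination (k ^ 3)⁻¹ * h7

theorem _root_.inv_cube_lt_iff {a b : ℝ} (ha : 0 < a) (hb : 0 < b) :
    (a ^ 3)⁻¹ < (b ^ 3)⁻¹ ↔ b < a := by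
  rw [inv_lt_inv₀ (by positivity) (by positivity), pow_lt_pow_iff_left₀ hb.le ha.le three_ne_zero]

theorem _root_.inv_cube_le_iff {a b : ℝ} (ha : 0 < a) (hb : 0 < b) :
    (a ^ 3)⁻¹ ≤ (b ^ 3)⁻¹ ↔ b ≤ a := by
  rw [← not_lt, inv_cube_lt_iff hb ha, not_lt]

theorem false_of_eq {x α β ρ μ : ℝ} (hx : x ≠ 0) (h : ParallelogramBalance x x α β ρ μ) :
    False := by
  obtain ⟨⟨h1, h2, h3, h4⟩, h5, h6, h7⟩ := h
  have e {ρ : ℝ} (h3 : 0 < ρ)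
      (h6 : 2 * x * (ρ ^ 3)⁻¹ = (x + x) * (α ^ 3)⁻¹ + (x - x) * (β ^ 3)⁻¹) : ρ = α := by
    have : (ρ ^ 3)⁻¹ = (α ^ 3)⁻¹ :=
      mul_left_cancel₀ (mul_ne_zero two_ne_zero hx) (by linear_combination h6)
    exact (pow_left_inj₀ h3.le h1.le three_ne_zero).1 (inv_injective this)
  rw [e h3 h6, e h4 h7] at h5
  nlinarith

/-- `ρ⁻³` is a convex combination of `α⁻³` and `β⁻³`, while `μ⁻³` extrapolates beyond `α⁻³`, away
from `β⁻³`. If `α ≤ β`, both diagonals would be too short for the parallelogram law. -/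
theorem order {x y α β ρ μ : ℝ} (hy : 0 < y) (hyx : y < x)
    (h : ParallelogramBalance x y α β ρ μ) : β < ρ ∧ ρ < α ∧ α < μ := by
  obtain ⟨⟨h1, h2, h3, h4⟩, h5, h6, h7⟩ := h
  have hx : 0 < x := hy.trans hyx
  have hβα : β < α := by
    by_contra hle
    push Not at hle
    have hab := (inv_cube_le_iff h2 h1).2 hle
    have l1 : ρ ≤ β := by
      rw [← inv_cube_le_iff h2 h3]
      refine le_of_mul_le_mul_left ?_ (by linarith : 0 < 2 * x)
      rw [h6]
      nlinarith
    have l2 : μ ≤ α := by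
      rw [← inv_cube_le_iff h1 h4]
      refine le_of_mul_le_mul_left ?_ (by linarith : 0 < 2 * y)
      rw [h7]
      nlinarith
    nlinarith
  have hab := (inv_cube_lt_iff h1 h2).2 hβα
  have l1 : β < ρ := by
    rw [← inv_cube_lt_iff h3 h2]
    refine lt_of_mul_lt_mul_left ?_ (by linarith : 0 ≤ 2 * x)
    rw [h6]
    nlinarith
  have l2 : ρ < α := by
    rw [← inv_cube_lt_iff h1 h3]
    refine lt_of_mul_lt_mul_left ?_ (by linarith : 0 ≤ 2 * x)
    rw [h6]
    nlinarith
  have l3 : α < μ := by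
    rw [← inv_cube_lt_iff h4 h1]
    refine lt_of_mul_lt_mul_left ?_ (by linarith : 0 ≤ 2 * y)
    rw [h7]
    nlinarith
  exact ⟨l1, l2, l3⟩

/-- The derivatives of `-s⁻³` and `s²` have ratio `3/2 * s⁻⁵`, so `3/2` is the threshold at `s = 1`;
the companion bound treats `s ≥ 1`. -/
theorem _root_.sq_sub_sq_le_inv_cube_sub {a b : ℝ} (ha : 0 < a) (hab : a ≤ b) (hb : b ≤ 1) :
    3 / 2 * (b ^ 2 - a ^ 2) ≤ (a ^ 3)⁻¹ - (b ^ 3)⁻¹ := by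
  have hb0 : 0 < b := ha.trans_le hab
  have hp : a * b ≤ 1 := by nlinarith
  have hp0 : 0 < a * b := by positivity
  have e : (a ^ 3)⁻¹ - (b ^ 3)⁻¹ = (b - a) * (a ^ 2 + a * b + b ^ 2) / (a * b) ^ 3 := by
    field_simp
    ring
  rw [e, le_div_iff₀ (by positivity)]
  have h1 : (a * b) ^ 3 ≤ a * b := by
    calc (a * b) ^ 3 ≤ (a * b) ^ 1 := pow_le_pow_of_le_one hp0.le hp (by norm_num)
      _ = a * b := pow_one _
  have h2 : 3 / 2 * ((b + a) * (a * b) ^ 3) ≤ a ^ 2 + a * b + b ^ 2 := by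
    have : (b + a) * (a * b) ^ 3 ≤ 2 * (a * b) := by gcongr; linarith
    nlinarith [sq_nonneg (a - b)]
  have := mul_le_mul_of_nonneg_left h2 (sub_nonneg.2 hab)
  linarith

theorem _root_.inv_cube_sub_le_sq_sub_sq {a b : ℝ} (ha : 1 ≤ a) (hab : a ≤ b) :
    (a ^ 3)⁻¹ - (b ^ 3)⁻¹ ≤ 3 / 2 * (b ^ 2 - a ^ 2) := by
  have ha0 : 0 < a := by linarith
  have hb0 : 0 < b := by linarith
  have hp : 1 ≤ a * b := by nlinarith
  have e : (a ^ 3)⁻¹ - (b ^ 3)⁻¹ = (b - a) * (a ^ 2 + a * b + b ^ 2) / (a * b) ^ 3 := by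
    field_simp
    ring
  rw [e, div_le_iff₀ (by positivity)]
  have h1 : a * b ≤ (a * b) ^ 3 := by
    calc a * b = (a * b) ^ 1 := (pow_one _).symm
      _ ≤ (a * b) ^ 3 := pow_le_pow_right₀ hp (by norm_num)
  have h2 : a ^ 2 + a * b + b ^ 2 ≤ 3 / 2 * ((b + a) * (a * b) ^ 3) := by
    have h3 : (b + a) * (a * b) ≤ (b + a) * (a * b) ^ 3 := by gcongr
    have h4 : a ^ 2 + b ^ 2 ≤ (b + a) * (a * b) := by
      nlinarith [mul_nonneg (sub_nonneg.2 ha) (sq_nonneg b),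
        mul_nonneg (sub_nonneg.2 (ha.trans hab)) (sq_nonneg a)]
    nlinarith [sq_nonneg (a - b)]
  have := mul_le_mul_of_nonneg_left h2 (sub_nonneg.2 hab)
  linarith

theorem not_lt_of_unit_side {x y β ρ μ β' ρ' μ' : ℝ} (hy : 0 < y) (hyx : y < x)
    (h : ParallelogramBalance x y 1 β ρ μ) (h' : ParallelogramBalance x y 1 β' ρ' μ') :
    ¬ β < β' := by
  intro hlt
  obtain ⟨-, o2, -⟩ := h.order hy hyx
  obtain ⟨-, o2', o3'⟩ := h'.order hy hyx
  obtain ⟨⟨-, h2, h3, h4⟩, h5, h6, h7⟩ := h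
  obtain ⟨⟨-, h2', h3', h4'⟩, h5', h6', h7'⟩ := h'
  have hx : 0 < x := hy.trans hyx
  have hb := (inv_cube_lt_iff h2' h2).2 hlt
  have hρ : (ρ' ^ 3)⁻¹ < (ρ ^ 3)⁻¹ := by
    refine lt_of_mul_lt_mul_left ?_ (by linarith : 0 ≤ 2 * x)
    rw [h6, h6']
    nlinarith
  -- Adding the balance equations cancels `β`: `x ρ⁻³ + y μ⁻³ = x + y`. So a growing `ρ` makes `μ`
  -- shrink, and since `y < x` the square of `μ` loses more than that of `ρ` gains, whereas a larger
  -- `β` requires a larger sum of squares.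
  have hrel : x * ((ρ ^ 3)⁻¹ - (ρ' ^ 3)⁻¹) = y * ((μ' ^ 3)⁻¹ - (μ ^ 3)⁻¹) := by linarith
  have hμ : (ρ ^ 3)⁻¹ - (ρ' ^ 3)⁻¹ < (μ' ^ 3)⁻¹ - (μ ^ 3)⁻¹ := by
    refine lt_of_mul_lt_mul_left ?_ hy.le
    rw [← hrel]
    exact mul_lt_mul_of_pos_right hyx (by linarith)
  have hρ' := (inv_cube_lt_iff h3' h3).1 hρ
  have hμ' := (inv_cube_lt_iff h4 h4').1 (by linarith : (μ ^ 3)⁻¹ < (μ' ^ 3)⁻¹)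
  have k1 := sq_sub_sq_le_inv_cube_sub h3 hρ'.le o2'.le
  have k2 := inv_cube_sub_le_sq_sub_sq o3'.le hμ'.le
  nlinarith

theorem unique_of_pos {x y α β ρ μ α' β' ρ' μ' : ℝ} (hy : 0 < y) (hyx : y < x)
    (h : ParallelogramBalance x y α β ρ μ) (h' : ParallelogramBalance x y α' β' ρ' μ') :
    ∃ k, 0 < k ∧ α = k * α' ∧ β = k * β' ∧ ρ = k * ρ' ∧ μ = k * μ' := by
  have hα := h.1.1
  have hα' := h'.1.1
  have s := h.scale (inv_pos.2 hα)
  have s' := h'.scale (inv_pos.2 hα')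
  rw [inv_mul_cancel₀ hα.ne'] at s
  rw [inv_mul_cancel₀ hα'.ne'] at s'
  have e : α⁻¹ * β = α'⁻¹ * β' :=
    le_antisymm (not_lt.1 (not_lt_of_unit_side hy hyx s' s))
      (not_lt.1 (not_lt_of_unit_side hy hyx s s'))
  have hx : 0 < x := hy.trans hyx
  have eρ : α⁻¹ * ρ = α'⁻¹ * ρ' := by
    obtain ⟨⟨-, -, h3, -⟩, -, h6, -⟩ := s
    obtain ⟨⟨-, -, h3', -⟩, -, h6', -⟩ := s'
    rw [e, ← h6'] at h6
    exact (pow_left_inj₀ h3.le h3'.le three_ne_zero).1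
      (inv_injective (mul_left_cancel₀ (by positivity) h6))
  have eμ : α⁻¹ * μ = α'⁻¹ * μ' := by
    obtain ⟨⟨-, -, -, h4⟩, -, -, h7⟩ := s
    obtain ⟨⟨-, -, -, h4'⟩, -, -, h7'⟩ := s'
    rw [e, ← h7'] at h7
    exact (pow_left_inj₀ h4.le h4'.le three_ne_zero).1
      (inv_injective (mul_left_cancel₀ (by positivity) h7))
  have conv {β β' : ℝ} (e : α⁻¹ * β = α'⁻¹ * β') : β = α / α' * β' := by
    field_simp at e ⊢
    linarith
  exact ⟨α / α', by positivity, by field_simp, conv e, conv eρ, conv eμ⟩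

theorem _root_.inv_rpow_cube {s : ℝ} (hs : 0 < s) : ((s ^ (-(1 / 3) : ℝ)) ^ 3)⁻¹ = s := by
  rw [← Real.rpow_natCast, ← Real.rpow_mul hs.le, ← Real.rpow_neg hs.le]
  norm_num

theorem exists_of_pos {x y : ℝ} (hy : 0 < y) (hyx : y < x) :
    ∃ α β ρ μ, ParallelogramBalance x y α β ρ μ ∧ (α ^ 2 - β ^ 2) ^ 2 < ρ ^ 2 * μ ^ 2 := by
  have hx : 0 < x := hy.trans hyx
  -- With `α = 1` and `μ = M`, the balance equations are solved by `β⁻³ = s M` and `ρ⁻³ = p M`. Only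
  -- the parallelogram law remains; its defect `Ψ` changes sign on `[1, 2]`.
  obtain ⟨s, hs⟩ : ∃ s : ℝ → ℝ, s = fun M => ((x + y) - 2 * y * (M ^ 3)⁻¹) / (x - y) := ⟨_, rfl⟩
  obtain ⟨p, hp⟩ : ∃ p : ℝ → ℝ, p = fun M => ((x + y) - y * (M ^ 3)⁻¹) / x := ⟨_, rfl⟩
  have hinv {M : ℝ} (hM : 1 ≤ M) : (M ^ 3)⁻¹ ≤ 1 := inv_le_one_of_one_le₀ (one_le_pow₀ hM)
  have s1 {M : ℝ} (hM : 1 ≤ M) : 1 ≤ s M := by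
    simp only [hs]
    rw [one_le_div (by linarith)]
    nlinarith [hinv hM]
  have p1 {M : ℝ} (hM : 1 ≤ M) : 1 ≤ p M := by
    simp only [hp]
    rw [one_le_div hx]
    nlinarith [hinv hM]
  have cont3 : ContinuousOn (fun M : ℝ => (M ^ 3)⁻¹) (Set.Icc 1 2) := by
    refine ContinuousOn.inv₀ (by fun_prop) fun M hM => ?_
    have := hM.1
    positivity
  have sc : ContinuousOn s (Set.Icc 1 2) := by
    rw [hs]
    exact (continuousOn_const.sub (continuousOn_const.mul cont3)).div_const _
  have pc : ContinuousOn p (Set.Icc 1 2) := by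
    rw [hp]
    exact (continuousOn_const.sub (continuousOn_const.mul cont3)).div_const _
  obtain ⟨Ψ, hΨ⟩ : ∃ Ψ : ℝ → ℝ, Ψ = fun M =>
    (p M ^ (-(1 / 3) : ℝ)) ^ 2 + M ^ 2 - 2 * (1 + (s M ^ (-(1 / 3) : ℝ)) ^ 2) := ⟨_, rfl⟩
  have Ψc : ContinuousOn Ψ (Set.Icc 1 2) := by
    rw [hΨ]
    refine ((ContinuousOn.pow ?_ 2).add (by fun_prop)).sub
      (continuousOn_const.mul (continuousOn_const.add (ContinuousOn.pow ?_ 2)))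
    · exact pc.rpow_const fun M hM => Or.inl (by linarith [p1 hM.1])
    · exact sc.rpow_const fun M hM => Or.inl (by linarith [s1 hM.1])
  have Ψ1 : Ψ 1 ≤ 0 := by
    have e1 : p 1 = 1 := by simp only [hp]; field_simp; ring
    have e2 : s 1 = 1 := by
      simp only [hs]
      rw [div_eq_one_iff_eq (by linarith)]; norm_num; ring
    simp only [hΨ, e1, e2]
    norm_num
  have Ψ2 : 0 ≤ Ψ 2 := by
    have t1 : s 2 ^ (-(1 / 3) : ℝ) ≤ 1 :=
      Real.rpow_le_one_of_one_le_of_nonpos (s1 (by norm_num)) (by norm_num)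
    have t0 : 0 ≤ s 2 ^ (-(1 / 3) : ℝ) := Real.rpow_nonneg (by linarith [s1 one_le_two]) _
    simp only [hΨ]
    nlinarith [sq_nonneg (p 2 ^ (-(1 / 3) : ℝ))]
  obtain ⟨M, hM, hM0⟩ := intermediate_value_Icc one_le_two Ψc ⟨Ψ1, Ψ2⟩
  have hs0 : 0 < s M := by linarith [s1 hM.1]
  have hp0 : 0 < p M := by linarith [p1 hM.1]
  have hMpos : 0 < M := by linarith [hM.1]
  have es : s M * (x - y) = (x + y) - 2 * y * (M ^ 3)⁻¹ := by
    simp only [hs]; exact div_mul_cancel₀ _ (by linarith)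
  have ep : p M * x = (x + y) - y * (M ^ 3)⁻¹ := by
    simp only [hp]; exact div_mul_cancel₀ _ hx.ne'
  have B : ParallelogramBalance x y 1 (s M ^ (-(1 / 3) : ℝ)) (p M ^ (-(1 / 3) : ℝ)) M := by
    refine ⟨⟨one_pos, by positivity, by positivity, hMpos⟩, ?_, ?_, ?_⟩
    · simp only [hΨ] at hM0; linarith
    · rw [inv_rpow_cube hs0, inv_rpow_cube hp0]
      linear_combination 2 * ep - es
    · rw [inv_rpow_cube hs0]
      linear_combination es
  refine ⟨_, _, _, _, B, ?_⟩
  obtain ⟨o1, o2, o3⟩ := B.order hy hyx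
  have hR := inv_rpow_cube hp0
  generalize s M ^ (-(1 / 3) : ℝ) = t at *
  generalize p M ^ (-(1 / 3) : ℝ) = R at *
  have hR0 := B.1.2.2.1
  have ht0 := B.1.2.1
  -- The sum of `R⁻³` and `M⁻³` is less than `2`, so by AM-GM their product is less than `1`.
  have hRM : 1 < R * M := by
    have hlt : p M + (M ^ 3)⁻¹ < 2 := by
      have hM1 : (M ^ 3)⁻¹ < 1 := inv_lt_one_of_one_lt₀ (one_lt_pow₀ o3 three_ne_zero)
      have : x * (p M + (M ^ 3)⁻¹) < x * 2 := by nlinarith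
      exact lt_of_mul_lt_mul_left this hx.le
    by_contra hle
    push Not at hle
    have h1 : 1 ≤ ((R * M) ^ 3)⁻¹ :=
      (one_le_inv₀ (by positivity)).2 (pow_le_one₀ (by positivity) hle)
    rw [mul_pow, mul_inv, hR] at h1
    have h2 : 0 < (M ^ 3)⁻¹ := by positivity
    nlinarith [sq_nonneg (p M - (M ^ 3)⁻¹)]
  have h1 : (1 ^ 2 - t ^ 2) ^ 2 < 1 := by
    have : t < 1 := o1.trans o2
    have h3 : 0 < t ^ 2 := by positivity
    have h4 : t ^ 2 < 1 := by nlinarith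
    nlinarith
  have h2 : 1 < R ^ 2 * M ^ 2 := by
    rw [← mul_pow]; exact one_lt_pow₀ hRM two_ne_zero
  linarith

/-- Relabelling within a pair changes the sign of its mass parameter, and exchanging the pairs swaps
`x` and `y`; these symmetries reduce everything to `0 < y < x`. -/
theorem _root_.mass_induction {C : ℝ → ℝ → Prop} (base : ∀ x y, 0 < y → y < x → C x y)
    (flip : ∀ x y, C x y → C x (-y)) (swap : ∀ x y, C x y → C y x) {x y : ℝ}
    (hx : x ≠ 0) (hy : y ≠ 0) (hxy : x ≠ y) (hxy' : x ≠ -y) : C x y := by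
  have flip' (x y : ℝ) (h : C x y) : C (-x) y := swap _ _ (flip _ _ (swap _ _ h))
  have pos {x y : ℝ} (hx : 0 < x) (hy : 0 < y) (hxy : x ≠ y) : C x y := by
    rcases lt_or_gt_of_ne hxy with h | h
    · exact swap _ _ (base _ _ hx h)
    · exact base _ _ hy h
  rcases lt_or_gt_of_ne hx with gx | gx <;> rcases lt_or_gt_of_ne hy with gy | gy
  · have := flip' _ _ (flip _ _ (pos (neg_pos.2 gx) (neg_pos.2 gy) fun h => hxy (neg_injective h)))
    rwa [neg_neg, neg_neg] at this
  · have := flip' _ _ (pos (neg_pos.2 gx) gy fun h => hxy' (by linarith))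
    rwa [neg_neg] at this
  · have := flip _ _ (pos gx (neg_pos.2 gy) hxy')
    rwa [neg_neg] at this
  · exact pos gx gy hxy

theorem exists_of_ne {x y : ℝ} (hx : x ≠ 0) (hy : y ≠ 0) (hxy : x ≠ y) (hxy' : x ≠ -y) :
    ∃ α β ρ μ, ParallelogramBalance x y α β ρ μ ∧ (α ^ 2 - β ^ 2) ^ 2 < ρ ^ 2 * μ ^ 2 := by
  refine mass_induction (C := fun x y => ∃ α β ρ μ, ParallelogramBalance x y α β ρ μ ∧
    (α ^ 2 - β ^ 2) ^ 2 < ρ ^ 2 * μ ^ 2) (fun x y => exists_of_pos) ?_ ?_ hx hy hxy hxy'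
  · rintro x y ⟨α, β, ρ, μ, h, h'⟩
    exact ⟨β, α, ρ, μ, h.flip, by linarith⟩
  · rintro x y ⟨α, β, ρ, μ, h, h'⟩
    exact ⟨α, β, μ, ρ, h.swap, by linarith⟩

theorem unique {x y : ℝ} (hx : x ≠ 0) (hy : y ≠ 0) (hxy : x ≠ y) (hxy' : x ≠ -y)
    {α β ρ μ α' β' ρ' μ' : ℝ}
    (h : ParallelogramBalance x y α β ρ μ) (h' : ParallelogramBalance x y α' β' ρ' μ') :
    ∃ k, 0 < k ∧ α = k * α' ∧ β = k * β' ∧ ρ = k * ρ' ∧ μ = k * μ' := by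
  refine mass_induction (C := fun x y => ∀ {α β ρ μ α' β' ρ' μ' : ℝ},
    ParallelogramBalance x y α β ρ μ → ParallelogramBalance x y α' β' ρ' μ' →
    ∃ k, 0 < k ∧ α = k * α' ∧ β = k * β' ∧ ρ = k * ρ' ∧ μ = k * μ')
    (fun x y hy hyx => unique_of_pos hy hyx) ?_ ?_ hx hy hxy hxy' h h'
  · intro x y ih α β ρ μ α' β' ρ' μ' h h'
    have g := h.flip
    have g' := h'.flip
    rw [neg_neg] at g g'
    obtain ⟨k, h0, h1, h2, h3, h4⟩ := ih g g'
    exact ⟨k, h0, h2, h1, h3, h4⟩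
  · intro x y ih α β ρ μ α' β' ρ' μ' h h'
    obtain ⟨k, h0, h1, h2, h3, h4⟩ := ih h.swap h'.swap
    exact ⟨k, h0, h1, h2, h4, h3⟩

theorem order_of_ne {x y : ℝ} (hx : x ≠ 0) (hy : y ≠ 0) (hxy : x ≠ y) (hxy' : x ≠ -y)
    {α β ρ μ : ℝ} (h : ParallelogramBalance x y α β ρ μ) :
    (|x| < |y| → μ < ρ) ∧ (|y| < |x| → ρ < μ) ∧ (0 < x * y → β < α) ∧ (x * y < 0 → α < β) := by
  refine mass_induction (C := fun x y => ∀ {α β ρ μ : ℝ}, ParallelogramBalance x y α β ρ μ →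
    (|x| < |y| → μ < ρ) ∧ (|y| < |x| → ρ < μ) ∧ (0 < x * y → β < α) ∧ (x * y < 0 → α < β))
    ?_ ?_ ?_ hx hy hxy hxy' h
  · intro x y hy hyx α β ρ μ h
    obtain ⟨o1, o2, o3⟩ := h.order hy hyx
    have hx := hy.trans hyx
    rw [abs_of_pos hx, abs_of_pos hy]
    exact ⟨fun h => by linarith, fun _ => o2.trans o3, fun _ => o1.trans o2,
      fun h => by nlinarith⟩
  · intro x y ih α β ρ μ h
    have g := h.flip
    rw [neg_neg] at g
    obtain ⟨h1, h2, h3, h4⟩ := ih g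
    rw [abs_neg]
    exact ⟨h1, h2, fun h => h4 (by linarith), fun h => h3 (by linarith)⟩
  · intro x y ih α β ρ μ h
    obtain ⟨h1, h2, h3, h4⟩ := ih h.swap
    exact ⟨h2, h1, fun h => h3 (by linarith), fun h => h4 (by linarith)⟩

end ParallelogramBalance

/-! ### Accelerations in a parallelogram -/

theorem acceleration_eq_sum_univ {N : ℕ} {V : Type*} [NormedAddCommGroup V]
    [InnerProductSpace ℝ V] (m : Fin N → ℝ) (r : Fin N → V) (i : Fin N) :
    acceleration m r i = ∑ j, (m j / ‖r j - r i‖ ^ 3) • (r j - r i) :=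
  Finset.sum_erase _ (by simp)

theorem isCentralConfiguration_zero_iff {N : ℕ} {V : Type*} [NormedAddCommGroup V]
    [InnerProductSpace ℝ V] (m : Fin N → ℝ) (r : Fin N → V) :
    IsCentralConfiguration m r 0 ↔
      Function.Injective r ∧ ∀ i j, acceleration m r i = acceleration m r j := by
  simp only [IsCentralConfiguration, zero_smul, sub_eq_zero]
  exact and_congr_right fun _ => forall_comm

theorem collinear_range_of_forall_eq {V : Type*} [NormedAddCommGroup V] [InnerProductSpace ℝ V]
    {r : Fin 4 → V} {o v : V} (h : ∀ i, ∃ t : ℝ, r i = o + t • v) :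
    Collinear ℝ (Set.range r) := by
  rw [collinear_iff_exists_forall_eq_smul_vadd]
  refine ⟨o, v, ?_⟩
  rintro _ ⟨i, rfl⟩
  obtain ⟨t, ht⟩ := h i
  exact ⟨t, by rw [ht, vadd_eq_add, add_comm]⟩

section Parallelogram

variable {V : Type*} [NormedAddCommGroup V] [InnerProductSpace ℝ V] {r : Fin 4 → V}

/-- The point reflection in the centre exchanges opposite charges, so the two ends of a diagonal
have equal accelerations. Writing these along the diagonals leaves one vector equation with two
coefficients to compare. -/
theorem acceleration_of_add_eq_add (x y : ℝ) (h : r 0 + r 1 = r 2 + r 3) :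
    (∀ i ∈ ({0, 1} : Set (Fin 4)), acceleration (pairMasses x y) r i =
      (x * (‖r 0 - r 1‖ ^ 3)⁻¹ + y * ((‖r 0 - r 3‖ ^ 3)⁻¹ - (‖r 0 - r 2‖ ^ 3)⁻¹) / 2) •
          (r 0 - r 1) +
        (y * ((‖r 0 - r 2‖ ^ 3)⁻¹ + (‖r 0 - r 3‖ ^ 3)⁻¹) / 2) • (r 2 - r 3)) ∧
    (∀ i ∈ ({2, 3} : Set (Fin 4)), acceleration (pairMasses x y) r i =
      (x * ((‖r 0 - r 2‖ ^ 3)⁻¹ + (‖r 0 - r 3‖ ^ 3)⁻¹) / 2) • (r 0 - r 1) +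
      (y * (‖r 2 - r 3‖ ^ 3)⁻¹ + x * ((‖r 0 - r 3‖ ^ 3)⁻¹ - (‖r 0 - r 2‖ ^ 3)⁻¹) / 2) •
          (r 2 - r 3)) := by
  have h1 : r 1 = r 2 + r 3 - r 0 := by rw [← h]; abel
  have n1 : ‖r 1 - r 3‖ = ‖r 0 - r 2‖ := by rw [norm_sub_rev, h1]; congr 1; abel
  have n2 : ‖r 1 - r 2‖ = ‖r 0 - r 3‖ := by rw [norm_sub_rev, h1]; congr 1; abel
  have e10 := norm_sub_rev (r 1) (r 0)
  have e20 := norm_sub_rev (r 2) (r 0)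
  have e30 := norm_sub_rev (r 3) (r 0)
  have e21 := (norm_sub_rev (r 2) (r 1)).trans n2
  have e31 := (norm_sub_rev (r 3) (r 1)).trans n1
  have e32 := norm_sub_rev (r 3) (r 2)
  refine ⟨?_, ?_⟩
  all_goals
    rintro i (rfl | rfl)
    all_goals
      rw [acceleration_eq_sum_univ, Fin.sum_univ_four]
      simp only [pairMasses, Matrix.cons_val, n1, n2, e10, e20, e30, e21, e31, e32, sub_self,
        smul_zero, div_eq_mul_inv]
      generalize (‖r 0 - r 1‖ ^ 3)⁻¹ = s01
      generalize (‖r 0 - r 2‖ ^ 3)⁻¹ = s02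
      generalize (‖r 0 - r 3‖ ^ 3)⁻¹ = s03
      generalize (‖r 2 - r 3‖ ^ 3)⁻¹ = s23
      rw [h1]
      module

theorem isCentralConfiguration_zero_of_balance {x y : ℝ} (h : r 0 + r 1 = r 2 + r 3)
    (hr : Function.Injective r)
    (hb : ParallelogramBalance x y ‖r 0 - r 2‖ ‖r 0 - r 3‖ ‖r 0 - r 1‖ ‖r 2 - r 3‖) :
    IsCentralConfiguration (pairMasses x y) r 0 := by
  obtain ⟨-, -, h6, h7⟩ := hb
  obtain ⟨a1, a2⟩ := acceleration_of_add_eq_add x y h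
  rw [isCentralConfiguration_zero_iff]
  have key : ∀ i, acceleration (pairMasses x y) r i = acceleration (pairMasses x y) r 0 := by
    have a20 : acceleration (pairMasses x y) r 2 = acceleration (pairMasses x y) r 0 := by
      rw [a1 0 (by simp), a2 2 (by simp)]
      congr 2 <;> linarith
    intro i
    fin_cases i
    · rfl
    · exact (a1 1 (by simp)).trans (a1 0 (by simp)).symm
    · exact a20
    · exact ((a2 3 (by simp)).trans (a2 2 (by simp)).symm).trans a20
  exact ⟨hr, fun i j => (key i).trans (key j).symm⟩

theorem eq_zero_of_smul_diagonals_eq_zero (h : r 0 + r 1 = r 2 + r 3)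
    (hr : ¬ Collinear ℝ (Set.range r)) {s t : ℝ}
    (hst : s • (r 0 - r 1) + t • (r 2 - r 3) = 0) : s = 0 ∧ t = 0 := by
  have e0 : r 0 = (1 / 2 : ℝ) • (r 2 + r 3) + (1 / 2 : ℝ) • (r 0 - r 1) := by
    rw [← h]; module
  have e1 : r 1 = (1 / 2 : ℝ) • (r 2 + r 3) + (-1 / 2 : ℝ) • (r 0 - r 1) := by
    rw [← h]; module
  have e2 : r 2 = (1 / 2 : ℝ) • (r 2 + r 3) + (1 / 2 : ℝ) • (r 2 - r 3) := by module
  have e3 : r 3 = (1 / 2 : ℝ) • (r 2 + r 3) + (-1 / 2 : ℝ) • (r 2 - r 3) := by module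
  by_contra hne
  rw [not_and_or] at hne
  apply hr
  rcases hne with hs | ht
  · have hd : r 0 - r 1 = (-(s⁻¹ * t)) • (r 2 - r 3) := by
      have := congrArg (fun z => s⁻¹ • z) hst
      simp only [smul_add, smul_smul, inv_mul_cancel₀ hs, one_smul, smul_zero] at this
      rw [neg_smul]
      exact eq_neg_of_add_eq_zero_left this
    rw [hd, smul_smul] at e0 e1
    refine collinear_range_of_forall_eq (o := (1 / 2 : ℝ) • (r 2 + r 3)) (v := r 2 - r 3)
      fun i => ?_
    fin_cases i
    exacts [⟨_, e0⟩, ⟨_, e1⟩, ⟨_, e2⟩, ⟨_, e3⟩]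
  · have hd : r 2 - r 3 = (-(t⁻¹ * s)) • (r 0 - r 1) := by
      have := congrArg (fun z => t⁻¹ • z) hst
      simp only [smul_add, smul_smul, inv_mul_cancel₀ ht, one_smul, smul_zero] at this
      rw [neg_smul]
      exact eq_neg_of_add_eq_zero_right this
    rw [hd, smul_smul] at e2 e3
    refine collinear_range_of_forall_eq (o := (1 / 2 : ℝ) • (r 2 + r 3)) (v := r 0 - r 1)
      fun i => ?_
    fin_cases i
    exacts [⟨_, e0⟩, ⟨_, e1⟩, ⟨_, e2⟩, ⟨_, e3⟩]

theorem balance_of_isCentralConfiguration_zero {x y : ℝ} (h : r 0 + r 1 = r 2 + r 3)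
    (hr : ¬ Collinear ℝ (Set.range r)) (hc : IsCentralConfiguration (pairMasses x y) r 0) :
    ParallelogramBalance x y ‖r 0 - r 2‖ ‖r 0 - r 3‖ ‖r 0 - r 1‖ ‖r 2 - r 3‖ := by
  obtain ⟨hi, ha⟩ := (isCentralConfiguration_zero_iff _ _).1 hc
  obtain ⟨a1, a2⟩ := acceleration_of_add_eq_add x y h
  have h02 := ha 0 2
  rw [a1 0 (by simp), a2 2 (by simp), ← sub_eq_zero, add_sub_add_comm, ← sub_smul,
    ← sub_smul] at h02
  obtain ⟨k1, k2⟩ := eq_zero_of_smul_diagonals_eq_zero h hr h02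
  have pos {i j : Fin 4} (hij : i ≠ j) : 0 < ‖r i - r j‖ :=
    norm_pos_iff.2 (sub_ne_zero.2 (hi.ne hij))
  refine ⟨⟨pos (by decide), pos (by decide), pos (by decide), pos (by decide)⟩, ?_, ?_, ?_⟩
  · have := parallelogram_law_with_norm ℝ (r 0 - r 2) (r 0 - r 3)
    have e1 : r 0 - r 2 + (r 0 - r 3) = r 0 - r 1 := by
      rw [show r 1 = r 2 + r 3 - r 0 by rw [← h]; abel]; abel
    rw [e1, sub_sub_sub_cancel_left, norm_sub_rev (r 3)] at this
    linarith
  · linarith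
  · linarith

theorem isParallelogram_of_add_eq_add (h : r 0 + r 1 = r 2 + r 3)
    (hr : ¬ Collinear ℝ (Set.range r)) : IsParallelogram (r 0) (r 2) (r 1) (r 3) := by
  refine ⟨?_, fun hcol => hr ?_⟩
  · rw [sub_eq_sub_iff_add_eq_add, ← h, add_comm]
  · obtain ⟨v, hv⟩ := (collinear_iff_of_mem (p₀ := r 0) (by simp)).1 hcol
    obtain ⟨s, hs⟩ := hv (r 1) (by simp)
    obtain ⟨t, ht⟩ := hv (r 2) (by simp)
    rw [vadd_eq_add] at hs ht
    refine collinear_range_of_forall_eq (o := r 0) (v := v) fun i => ?_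
    fin_cases i
    · exact ⟨0, by simp⟩
    · exact ⟨s, by rw [add_comm]; exact hs⟩
    · exact ⟨t, by rw [add_comm]; exact ht⟩
    · refine ⟨s - t, ?_⟩
      have : r 3 = r 0 + r 1 - r 2 := by rw [h]; abel
      change r 3 = _
      rw [this, hs, ht]
      module

end Parallelogram

/-! ### From central configurations to parallelograms and back -/

theorem add_eq_add_of_isPlanarNoncollinearCC {x y : ℝ} (hy : y ≠ 0)
    {r : Fin 4 → EuclideanSpace ℝ (Fin 2)} (h : IsPlanarNoncollinearCC (pairMasses x y) r 0) :
    r 0 + r 1 = r 2 + r 3 := by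
  obtain ⟨hc, hcol⟩ := h
  obtain ⟨hi, ha⟩ := (isCentralConfiguration_zero_iff _ _).1 hc
  have h01 := ha 0 1
  rw [acceleration_eq_sum_univ, acceleration_eq_sum_univ, Fin.sum_univ_four,
    Fin.sum_univ_four] at h01
  simp only [pairMasses, Matrix.cons_val, norm_sub_rev (r 1) (r 0), sub_self,
    smul_zero, div_eq_mul_inv] at h01
  -- The mutual terms of bodies `0` and `1` are equal and cancel, leaving `y` times the field of
  -- bodies `2, 3`.
  have hE : (‖r 2 - r 0‖ ^ 3)⁻¹ • (r 2 - r 0) - (‖r 3 - r 0‖ ^ 3)⁻¹ • (r 3 - r 0) =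
      (‖r 2 - r 1‖ ^ 3)⁻¹ • (r 2 - r 1) - (‖r 3 - r 1‖ ^ 3)⁻¹ • (r 3 - r 1) := by
    apply smul_right_injective _ hy
    rw [← sub_eq_zero] at h01 ⊢
    rw [← h01]
    module
  let f := Complex.orthonormalBasisOneI.repr.symm
  have hf := congrArg f hE
  simp only [map_sub, map_smul] at hf
  have nf (a b : EuclideanSpace ℝ (Fin 2)) : ‖a - b‖ = ‖f a - f b‖ := by
    rw [← map_sub, f.norm_map]
  rw [nf, nf, nf, nf] at hf
  have ne {i j : Fin 4} (hij : i ≠ j) : f (r i) ≠ f (r j) := f.injective.ne (hi.ne hij)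
  rcases two_centre_field_injective (ne (by decide)) (ne (by decide)) (ne (by decide))
    (ne (by decide)) (ne (by decide)) hf with g | g | ⟨s, t, g1, g2⟩
  · exact absurd g (ne (by decide))
  · rw [← map_add, ← map_add] at g
    exact f.injective g
  · refine absurd (collinear_range_of_forall_eq (o := r 3) (v := r 2 - r 3) fun i => ?_) hcol
    rw [← map_sub, ← map_smul, ← map_add] at g1 g2
    fin_cases i
    · exact ⟨s, f.injective g1⟩
    · exact ⟨t, f.injective g2⟩
    · exact ⟨1, by simp⟩
    · exact ⟨0, by simp⟩

/-- The inner product of the diagonals is `β² - α²`, so `hlt` is strict Cauchy–Schwarz: the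
diagonals are not parallel. -/
theorem exists_isPlanarNoncollinearCC {x y α β ρ μ : ℝ}
    (h : ParallelogramBalance x y α β ρ μ) (hlt : (α ^ 2 - β ^ 2) ^ 2 < ρ ^ 2 * μ ^ 2) :
    ∃ r : Fin 4 → EuclideanSpace ℝ (Fin 2), IsPlanarNoncollinearCC (pairMasses x y) r 0 := by
  obtain ⟨⟨h1, h2, h3, h4⟩, h5, -, -⟩ := id h
  -- With the centre at `0` and the first diagonal horizontal, `a` is the abscissa of body `2`, read
  -- off from `β² - α² = 2aρ`; its ordinate `b` then comes from the half-diagonal `μ / 2`.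
  obtain ⟨a, ha⟩ : ∃ a, a = (β ^ 2 - α ^ 2) / (2 * ρ) := ⟨_, rfl⟩
  have haρ : 2 * a * ρ = β ^ 2 - α ^ 2 := by rw [ha]; field_simp
  have hpos : 0 < μ ^ 2 / 4 - a ^ 2 := by
    have : 0 < 4 * ρ ^ 2 * (μ ^ 2 / 4 - a ^ 2) := by
      have : 4 * ρ ^ 2 * (μ ^ 2 / 4 - a ^ 2) = ρ ^ 2 * μ ^ 2 - (2 * a * ρ) ^ 2 := by ring
      rw [this, haρ]; linarith
    exact (pos_iff_pos_of_mul_pos this).1 (by positivity)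
  obtain ⟨b, hb⟩ : ∃ b, b = √(μ ^ 2 / 4 - a ^ 2) := ⟨_, rfl⟩
  have hb0 : 0 < b := by rw [hb]; exact Real.sqrt_pos.2 hpos
  have hb2 : b ^ 2 = μ ^ 2 / 4 - a ^ 2 := by rw [hb]; exact Real.sq_sqrt hpos.le
  clear ha hb
  let r : Fin 4 → EuclideanSpace ℝ (Fin 2) := ![!₂[ρ / 2, 0], !₂[-ρ / 2, 0], !₂[a, b], !₂[-a, -b]]
  have nrm {u v : EuclideanSpace ℝ (Fin 2)} {d : ℝ} (hd : 0 < d)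
      (hsq : (u 0 - v 0) ^ 2 + (u 1 - v 1) ^ 2 = d ^ 2) : ‖u - v‖ = d := by
    rw [EuclideanSpace.norm_eq, Fin.sum_univ_two]
    simp only [Real.norm_eq_abs, sq_abs, PiLp.sub_apply]
    rw [hsq, Real.sqrt_sq hd.le]
  have n02 : ‖r 0 - r 2‖ = α := nrm h1 (by
    simp only [r, Matrix.cons_val]
    simp
    linarith)
  have n03 : ‖r 0 - r 3‖ = β := nrm h2 (by
    simp only [r, Matrix.cons_val]
    simp
    linarith)
  have n01 : ‖r 0 - r 1‖ = ρ := nrm h3 (by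
    simp only [r, Matrix.cons_val]
    simp
    ring)
  have n23 : ‖r 2 - r 3‖ = μ := nrm h4 (by
    simp only [r, Matrix.cons_val]
    simp
    linarith)
  have hsum : r 0 + r 1 = r 2 + r 3 := by
    ext i
    fin_cases i <;> (simp [r]; try ring)
  have ncol : ¬ Collinear ℝ (Set.range r) := by
    intro hcol
    obtain ⟨v, hv⟩ := (collinear_iff_of_mem (p₀ := r 0) (Set.mem_range_self 0)).1 hcol
    obtain ⟨s, hs⟩ := hv (r 1) (Set.mem_range_self 1)
    obtain ⟨t, ht⟩ := hv (r 2) (Set.mem_range_self 2)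
    have s0 := congrArg (fun z => z 0) hs
    have s1 := congrArg (fun z => z 1) hs
    have t1 := congrArg (fun z => z 1) ht
    simp [r] at s0 s1 t1
    rcases s1 with rfl | hv1
    · linarith
    · rw [hv1] at t1
      linarith
  have ne {i j : Fin 4} {d : ℝ} (hd : 0 < d) (hn : ‖r i - r j‖ = d) : r i ≠ r j := by
    rw [← sub_ne_zero, ← norm_pos_iff, hn]; exact hd
  have n13 : ‖r 1 - r 3‖ = α := by
    rw [← n02, norm_sub_rev, show r 1 = r 2 + r 3 - r 0 by rw [← hsum]; abel]
    congr 1; abel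
  have n12 : ‖r 1 - r 2‖ = β := by
    rw [← n03, norm_sub_rev, show r 1 = r 2 + r 3 - r 0 by rw [← hsum]; abel]
    congr 1; abel
  have inj : Function.Injective r := by
    have i01 := ne h3 n01
    have i02 := ne h1 n02
    have i03 := ne h2 n03
    have i12 := ne h2 n12
    have i13 := ne h1 n13
    have i23 := ne h4 n23
    clear_value r
    intro i j hij
    fin_cases i <;> fin_cases j <;> first | rfl | exact absurd hij ‹_› | exact absurd hij.symm ‹_›
  refine ⟨r, isCentralConfiguration_zero_of_balance hsum inj ?_, ncol⟩
  rw [n02, n03, n01, n23]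
  exact h

/-- The two sides and two diagonals fix all six distances, and proportional distances are exactly
similarity, reflections included. -/
theorem similar_of_balance {x y : ℝ} (hx : x ≠ 0) (hy : y ≠ 0) (hxy : x ≠ y) (hxy' : x ≠ -y)
    {r r' : Fin 4 → EuclideanSpace ℝ (Fin 2)} (h : r 0 + r 1 = r 2 + r 3)
    (h' : r' 0 + r' 1 = r' 2 + r' 3)
    (hb : ParallelogramBalance x y ‖r 0 - r 2‖ ‖r 0 - r 3‖ ‖r 0 - r 1‖ ‖r 2 - r 3‖)
    (hb' : ParallelogramBalance x y ‖r' 0 - r' 2‖ ‖r' 0 - r' 3‖ ‖r' 0 - r' 1‖ ‖r' 2 - r' 3‖) :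
    Similar r r' := by
  obtain ⟨k, hk, k02, k03, k01, k23⟩ := ParallelogramBalance.unique hx hy hxy hxy' hb hb'
  have opp {r : Fin 4 → EuclideanSpace ℝ (Fin 2)} (h : r 0 + r 1 = r 2 + r 3) :
      dist (r 1) (r 3) = dist (r 0) (r 2) ∧ dist (r 1) (r 2) = dist (r 0) (r 3) := by
    simp only [dist_eq_norm]
    rw [show r 1 = r 2 + r 3 - r 0 by rw [← h]; abel, norm_sub_rev (r 0), norm_sub_rev (r 0)]
    exact ⟨congrArg _ (by abel), congrArg _ (by abel)⟩
  obtain ⟨o1, o2⟩ := opp h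
  obtain ⟨o1', o2'⟩ := opp h'
  simp only [← dist_eq_norm] at k02 k03 k01 k23
  have k13 : dist (r 1) (r 3) = k * dist (r' 1) (r' 3) := by rw [o1, o1', k02]
  have k12 : dist (r 1) (r 2) = k * dist (r' 1) (r' 2) := by rw [o2, o2', k03]
  have symm {i j : Fin 4} (h : dist (r i) (r j) = k * dist (r' i) (r' j)) :
      dist (r j) (r i) = k * dist (r' j) (r' i) := by
    rwa [dist_comm (r j), dist_comm (r' j)]
  rw [similar_iff_exists_dist_eq]
  refine ⟨⟨k, hk.le⟩, fun h0 => hk.ne' (congrArg NNReal.toReal h0), fun i j => ?_⟩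
  change dist (r i) (r j) = k * dist (r' i) (r' j)
  fin_cases i <;> fin_cases j <;>
    first
    | exact (dist_self _).trans (by rw [dist_self, mul_zero])
    | assumption
    | exact symm ‹_›

theorem mainTheorem2 :
    (∀ x : ℝ, x ≠ 0 →
      ¬ ∃ r : Fin 4 → EuclideanSpace ℝ (Fin 2), IsPlanarNoncollinearCC (pairMasses x x) r 0) ∧
    (∀ x y : ℝ, x ≠ 0 → y ≠ 0 → x ≠ y → x ≠ -y →
      -- existence, and uniqueness up to similarity
      (∃ r : Fin 4 → EuclideanSpace ℝ (Fin 2), IsPlanarNoncollinearCC (pairMasses x y) r 0) ∧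
      (∀ r r' : Fin 4 → EuclideanSpace ℝ (Fin 2),
        IsPlanarNoncollinearCC (pairMasses x y) r 0 →
        IsPlanarNoncollinearCC (pairMasses x y) r' 0 → Similar r r') ∧
      -- description of the configuration
      (∀ r : Fin 4 → EuclideanSpace ℝ (Fin 2), IsPlanarNoncollinearCC (pairMasses x y) r 0 →
        -- bodies `0, 1` (masses `x, -x`) and bodies `2, 3` (masses `y, -y`) span the diagonals
        IsParallelogram (r 0) (r 2) (r 1) (r 3) ∧
        -- the masses with the smaller absolute value are on the longer diagonal
        (|x| < |y| → dist (r 2) (r 3) < dist (r 0) (r 1)) ∧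
        (|y| < |x| → dist (r 0) (r 1) < dist (r 2) (r 3)) ∧
        -- a side with masses of the same sign is longer than a side with masses of opposite signs
        (∀ i ∈ ({0, 1} : Set (Fin 4)), ∀ j ∈ ({2, 3} : Set (Fin 4)),
          ∀ i' ∈ ({0, 1} : Set (Fin 4)), ∀ j' ∈ ({2, 3} : Set (Fin 4)),
            0 < pairMasses x y i * pairMasses x y j →
            pairMasses x y i' * pairMasses x y j' < 0 →
            dist (r i') (r j') < dist (r i) (r j)))) := by
  refine ⟨?_, fun x y hx hy hxy hxy' => ⟨?_, ?_, ?_⟩⟩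
  · rintro x hx ⟨r, h⟩
    exact (balance_of_isCentralConfiguration_zero
      (add_eq_add_of_isPlanarNoncollinearCC hx h) h.2 h.1).false_of_eq hx
  · obtain ⟨α, β, ρ, μ, h, h'⟩ := ParallelogramBalance.exists_of_ne hx hy hxy hxy'
    exact exists_isPlanarNoncollinearCC h h'
  · intro r r' h h'
    have e := add_eq_add_of_isPlanarNoncollinearCC hy h
    have e' := add_eq_add_of_isPlanarNoncollinearCC hy h'
    exact similar_of_balance hx hy hxy hxy' e e'
      (balance_of_isCentralConfiguration_zero e h.2 h.1)
      (balance_of_isCentralConfiguration_zero e' h'.2 h'.1)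
  · intro r h
    have e := add_eq_add_of_isPlanarNoncollinearCC hy h
    obtain ⟨o1, o2, o3, o4⟩ := (balance_of_isCentralConfiguration_zero e h.2 h.1).order_of_ne
      hx hy hxy hxy'
    have d13 : dist (r 1) (r 3) = ‖r 0 - r 2‖ := by
      rw [dist_eq_norm, norm_sub_rev (r 0), show r 1 = r 2 + r 3 - r 0 by rw [← e]; abel]
      congr 1; abel
    have d12 : dist (r 1) (r 2) = ‖r 0 - r 3‖ := by
      rw [dist_eq_norm, norm_sub_rev (r 0), show r 1 = r 2 + r 3 - r 0 by rw [← e]; abel]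
      congr 1; abel
    refine ⟨isParallelogram_of_add_eq_add e h.2, ?_, ?_, ?_⟩
    · simpa only [dist_eq_norm] using o1
    · simpa only [dist_eq_norm] using o2
    · rintro i (rfl | rfl) j (rfl | rfl) i' (rfl | rfl) j' (rfl | rfl) hp hn <;>
        simp only [pairMasses, Matrix.cons_val, d13, d12, dist_eq_norm (r 0)] at hp hn ⊢ <;>
        first
        | exact o3 (by linarith)
        | exact o4 (by linarith)
        | (exfalso; linarith)
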